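/- Let $q$ be a prime power, $m$ a positive integer and $K=\mathbb{F}_{q^m}$. Let $a,b$ be coprime positive integers and let $\mathcal{X}_{a,b}$ be a $C_{a,b}$ curve over $K$, that is, a curve with an irreducible, affine, non-singular plane model of equation $$f_{a,b}(x,y)=\alpha_{0a}y^a+\alpha_{b0}x^b+\sum_{ai+bj<ab}\alpha_{ij}x^iy^j=0,\qquad \alpha_{0a},\alpha_{b0}\neq 0.$$ Let $P_\infty$ be its point at infinity (the place of the function field of $\mathcal{X}_{a,b}$ at which $x$ or $y$ has a pole), and let $\mathcal{O}_{P_\infty}=\bigcup_{s\ge 0}\mathcal{L}(sP_\infty)$ be the ring of functions that are regular everywhere except possibly at $P_\infty$. For a function $h\neq 0$ in $\mathcal{O}_{P_\infty}$, write $\mathrm{LT}(h)=x^\beta y^\alpha$ if $\alpha\le a-1$ and $h=c\,x^\beta y^\alpha+h'$, where $c\in K^*$ and $h'$ is a $K$-linear combination of monomials $x^iy^j$ with $j\le a-1$ and $ai+bj<a\beta+b\alpha$; in this case $\deg_{a,b}h:=a\beta+b\alpha$. Put $\deg_{a,b}0:=-\infty$. Let $g\in\mathcal{O}_{P_\infty}$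 be nonzero. Then $g$ has a leading term, and if $\mathrm{LT}(g)=x^\beta y^\alpha$ (with $\alpha<a$) and $$\mathcal{R}(g):=\mathrm{Span}_K\{x^uy^v \mid 0\le u\le \beta+b-1,\ 0\le v\le a-1,\ \text{not both } u\ge\beta \text{ and } v\ge\alpha\},$$ then for every $f\in\mathcal{O}_{P_\infty}$ there are $f_1\in\mathcal{O}_{P_\infty}$ and $f_2\in\mathcal{R}(g)$ such that $f=f_1g+f_2$ and $\deg_{a,b}f_2\le\deg_{a,b}f$. Moreover, $\dim_K\mathcal{R}(g)=\deg_{a,b}g$. -/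

import Mathlib

/-- A `C_{a,b}` curve over `K`, given by its affine plane equation
`α_{0a} y^a + α_{b0} x^b + ∑_{ai+bj<ab} α_{ij} x^i y^j = 0`, with `a`, `b` coprime and positive,
irreducible and non-singular. The variable `x` has index `0` and `y` has index `1`. -/
structure CabCurve (K : Type*) [Field K] (a b : ℕ) where
  /-- the defining polynomial -/
  poly : MvPolynomial (Fin 2) K
  a_pos : 0 < a
  b_pos : 0 < b
  coprime : Nat.Coprime a b
  coeff_y : poly.coeff (Finsupp.single 1 a) ≠ 0
  coeff_x : poly.coeff (Finsupp.single 0 b) ≠ 0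
  support_le : ∀ e ∈ poly.support,
    e = Finsupp.single 1 a ∨ e = Finsupp.single 0 b ∨ a * e 0 + b * e 1 < a * b
  irreducible : Irreducible poly
  nonsingular : ∀ p : Fin 2 → AlgebraicClosure K, MvPolynomial.aeval p poly = 0 →
    ∃ i, MvPolynomial.aeval p (MvPolynomial.pderiv i poly) ≠ 0

namespace CabCurve

variable {K : Type*} [Field K] {a b : ℕ} (C : CabCurve K a b)

/-- The affine coordinate ring `K[x,y]/(f_{a,b})`. -/
abbrev CoordinateRing : Type _ := MvPolynomial (Fin 2) K ⧸ Ideal.span {C.poly}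

instance : IsDomain C.CoordinateRing := by
  have h : (Ideal.span {C.poly}).IsPrime :=
    (Ideal.span_singleton_prime C.irreducible.ne_zero).2 C.irreducible.prime
  exact Ideal.Quotient.isDomain _

/-- The function field of the curve. -/
abbrev FunctionField : Type _ := FractionRing C.CoordinateRing

/-- The function `x`. -/
noncomputable def x : C.FunctionField :=
  algebraMap C.CoordinateRing C.FunctionField (Ideal.Quotient.mk _ (MvPolynomial.X 0))

/-- The function `y`. -/
noncomputable def y : C.FunctionField :=
  algebraMap C.CoordinateRing C.FunctionField (Ideal.Quotient.mk _ (MvPolynomial.X 1))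

/-- A place of the function field, that is, a (closed) point of the smooth projective curve:
a proper valuation subring containing the constants. -/
structure Place where
  /-- the ring of functions regular at the place -/
  regular : ValuationSubring C.FunctionField
  const_mem : ∀ c : K, algebraMap K C.FunctionField c ∈ regular
  ne_top : regular ≠ ⊤

variable {C}

/-- A place is at infinity if it is not a point of the affine model, i.e. if `x` or `y` has a pole
there. -/
def Place.IsAtInfinity (P : C.Place) : Prop := C.x ∉ P.regular ∨ C.y ∉ P.regular

/-- `v_P(h) ≥ -s`. The valuation at `P` being discrete, the functions `t` vanishing at `P` are those
with `v_P(t) ≥ 1`, and the value `1` is attained. -/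
def Place.PoleOrderLE (P : C.Place) (s : ℕ) (h : C.FunctionField) : Prop :=
  ∀ t ∈ P.regular.nonunits, h * t ^ s ∈ P.regular

theorem Place.PoleOrderLE.mono {P : C.Place} {s s' : ℕ} (hs : s ≤ s') {h : C.FunctionField}
    (hh : P.PoleOrderLE s h) : P.PoleOrderLE s' h := by
  intro t ht
  have ht2 : t ∈ P.regular := P.regular.nonunits_subset ht
  have e : h * t ^ s' = h * t ^ s * t ^ (s' - s) := by
    rw [mul_assoc, ← pow_add, Nat.add_sub_cancel' hs]
  rw [e]
  exact mul_mem (hh t ht) (pow_mem ht2 _)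

/-- The Riemann--Roch space `L(sP)`: functions regular away from `P` and with a pole of order at
most `s` at `P`. -/
def Place.riemannRochSpace (P : C.Place) (s : ℕ) : Submodule K C.FunctionField where
  carrier := {h | (∀ Q : C.Place, Q ≠ P → h ∈ Q.regular) ∧ P.PoleOrderLE s h}
  add_mem' := by
    rintro h h' ⟨h1, h2⟩ ⟨h1', h2'⟩
    refine ⟨fun Q hQ => add_mem (h1 Q hQ) (h1' Q hQ), fun t ht => ?_⟩
    rw [add_mul]
    exact add_mem (h2 t ht) (h2' t ht)
  zero_mem' := ⟨fun Q _ => zero_mem _, fun t _ => by rw [zero_mul]; exact zero_mem _⟩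
  smul_mem' := by
    rintro c h ⟨h1, h2⟩
    refine ⟨fun Q hQ => ?_, fun t ht => ?_⟩
    · rw [Algebra.smul_def]
      exact mul_mem (Q.const_mem c) (h1 Q hQ)
    · rw [Algebra.smul_def, mul_assoc]
      exact mul_mem (P.const_mem c) (h2 t ht)

/-- The ring `O_P = ⋃_{s ≥ 0} L(sP)`. -/
def Place.ringO (P : C.Place) : Subalgebra K C.FunctionField where
  carrier := ⋃ s : ℕ, (P.riemannRochSpace s : Set C.FunctionField)
  mul_mem' := by
    intro h h' hh hh'
    obtain ⟨s, h1, h2⟩ := Set.mem_iUnion.1 hh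
    obtain ⟨s', h1', h2'⟩ := Set.mem_iUnion.1 hh'
    refine Set.mem_iUnion.2 ⟨s + s', fun Q hQ => mul_mem (h1 Q hQ) (h1' Q hQ), fun t ht => ?_⟩
    have e : h * h' * t ^ (s + s') = (h * t ^ s) * (h' * t ^ s') := by ring
    rw [e]
    exact mul_mem (h2 t ht) (h2' t ht)
  add_mem' := by
    intro h h' hh hh'
    obtain ⟨s, h1, h2⟩ := Set.mem_iUnion.1 hh
    obtain ⟨s', h1', h2'⟩ := Set.mem_iUnion.1 hh'
    exact Set.mem_iUnion.2 ⟨max s s', add_mem (S := Submodule K C.FunctionField)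
      (s := P.riemannRochSpace (max s s')) ⟨h1, h2.mono (le_max_left _ _)⟩
      ⟨h1', h2'.mono (le_max_right _ _)⟩⟩
  algebraMap_mem' := by
    intro c
    refine Set.mem_iUnion.2 ⟨0, fun Q _ => Q.const_mem c, fun t _ => ?_⟩
    rw [pow_zero, mul_one]
    exact P.const_mem c

variable (C)

/-- `LT(h) = x^β y^α` (up to the nonzero leading coefficient): `α ≤ a - 1`, and `h` is a nonzero
multiple of `x^β y^α` plus a combination of monomials `x^i y^j` with `j ≤ a - 1` and
`ai + bj < aβ + bα`. -/
def IsLeadingTerm (h : C.FunctionField) (β α : ℕ) : Prop :=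
  α < a ∧ ∃ c : K, c ≠ 0 ∧ h - c • (C.x ^ β * C.y ^ α) ∈
    Submodule.span K {m | ∃ i j : ℕ, j < a ∧ a * i + b * j < a * β + b * α ∧ m = C.x ^ i * C.y ^ j}

open Classical in
/-- The weighted degree `deg_{a,b} h = aβ + bα` where `LT(h) = x^β y^α`, and `⊥` for `h = 0`.
(A nonzero polynomial in `x` and `y` has exactly one leading term, so that the infimum is over
a set with one element.) -/
noncomputable def wdeg (h : C.FunctionField) : WithBot ℕ :=
  if h = 0 then ⊥
  else ((sInf {d : ℕ | ∃ β α : ℕ, C.IsLeadingTerm h β α ∧ d = a * β + b * α} : ℕ) : WithBot ℕ)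

/-- The space `R(g)` for a function `g` with `LT(g) = x^β y^α`. -/
noncomputable def remainderSpace (β α : ℕ) : Submodule K C.FunctionField :=
  Submodule.span K {m | ∃ u v : ℕ, u < β + b ∧ v < a ∧ ¬ (β ≤ u ∧ α ≤ v) ∧ m = C.x ^ u * C.y ^ v}

end CabCurve

/-!
Division with remainder by `g` is carried out in the coordinate ring `K[x, y] / (f_{a,b})`, and the
work lies in identifying this ring with the ring of functions regular away from infinity.

The equation writes `y^a` as a nonzero multiple of `x^b` plus terms of lower weighted degree. So the
monomials of weighted degree less than `d` have the same span whether or not one restricts to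
reduced monomials `x^i y^j`, `j < a` (`filtration_eq_reducedFiltration`); as `a` and `b` are coprime,
there is at most one reduced monomial of each weighted degree, and every nonzero polynomial in `x`
and `y` has a leading term (`exists_isLeadingTerm`). A reduced monomial not in `R(g)` is the leading
term of a monomial times `g`: directly if it is divisible by the leading term `x^β y^α` of `g`, and
after trading `x^b` for `y^a` if the exponent of `x` is at least `β + b`
(`exists_monomial_sub_smul_mul_mem`). Induction on the weighted degree gives the division
(`exists_sub_mul_mem`).

At a place at infinity the equation forces `v(y)^a = v(x)^b > 1`. Hence reduced monomials have
distinct valuations and the valuation of a polynomial depends only on its weighted degree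
(`Place.IsAtInfinity.valuation_pow_eq`). This gives the uniqueness of the leading term, the linear
independence of the reduced monomials, whence the dimension of `R(g)` by counting, and the fact that
there is only one place at infinity (`Place.IsAtInfinity.eq`), at which polynomials have poles of
finite order. So polynomials in `x` and `y` lie in `O_P`.

Conversely, the Jacobian criterion shows that the local rings of the non-singular affine curve have
principal maximal ideals (`isPrincipal_maximalIdeal`), so the coordinate ring is integrally closed
and is the intersection of the valuation rings containing it. None of these is the place at infinity,
and therefore `O_P` consists of polynomials in `x` and `y`
(`Place.IsAtInfinity.mem_range_of_mem_ringO`).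
-/

/-! ### Maximal ideals of polynomial rings and local principality -/

/-- The contraction of `M` to `A` is a maximal ideal `(u)`, and the image of `M` in the principal
ideal domain `(A / u)[X]` is generated by one element `v`. -/
theorem Polynomial.exists_span_pair_of_isMaximal {A : Type*} [CommRing A] [IsPrincipalIdealRing A]
    [IsJacobsonRing A] (M : Ideal (Polynomial A)) [M.IsMaximal] :
    ∃ u v : Polynomial A, M = Ideal.span {u, v} := by
  have hp : (M.comap Polynomial.C).IsMaximal := Polynomial.isMaximal_comap_C_of_isJacobsonRing M
  obtain ⟨u, hu⟩ := (IsPrincipalIdealRing.principal (M.comap Polynomial.C)).principal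
  let _ : Field (A ⧸ M.comap Polynomial.C) := Ideal.Quotient.field _
  let π : Polynomial A →+* Polynomial (A ⧸ M.comap Polynomial.C) :=
    Polynomial.mapRingHom (Ideal.Quotient.mk _)
  have hπ : Function.Surjective π := Polynomial.map_surjective _ Ideal.Quotient.mk_surjective
  obtain ⟨w, hw⟩ := (IsPrincipalIdealRing.principal (M.map π)).principal
  obtain ⟨v, rfl⟩ := hπ w
  have hker : RingHom.ker π = Ideal.span {Polynomial.C u} := by
    rw [Polynomial.ker_mapRingHom, Ideal.mk_ker, hu, Ideal.submodule_span_eq, Ideal.map_span,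
      Set.image_singleton]
  have huM : Polynomial.C u ∈ M := by
    rw [← Ideal.mem_comap, hu]
    exact Ideal.mem_span_singleton_self u
  refine ⟨Polynomial.C u, v, ?_⟩
  have h1 : (M.map π).comap π = M := by
    rw [Ideal.comap_map_of_surjective _ hπ, ← RingHom.ker_eq_comap_bot, hker, sup_eq_left,
      Ideal.span_singleton_le_iff_mem]
    exact huM
  rw [← h1, hw, Ideal.submodule_span_eq, ← Set.image_singleton, ← Ideal.map_span,
    Ideal.comap_map_of_surjective _ hπ, ← RingHom.ker_eq_comap_bot, hker, sup_comm,
    Ideal.span_insert]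

theorem MvPolynomial.exists_span_pair_of_isMaximal {K : Type*} [Field K]
    (M : Ideal (MvPolynomial (Fin 2) K)) [M.IsMaximal] :
    ∃ u v : MvPolynomial (Fin 2) K, M = Ideal.span {u, v} := by
  have : IsPrincipalIdealRing (MvPolynomial (Fin 1) K) :=
    IsPrincipalIdealRing.of_surjective (MvPolynomial.uniqueAlgEquiv K (Fin 1)).symm.toRingHom
      (MvPolynomial.uniqueAlgEquiv K (Fin 1)).symm.surjective
  let e := MvPolynomial.finSuccEquiv K 1
  have : (M.map e).IsMaximal := Ideal.map_isMaximal_of_equiv e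
  obtain ⟨u, v, h⟩ := Polynomial.exists_span_pair_of_isMaximal (M.map e)
  refine ⟨e.symm u, e.symm v, ?_⟩
  have hM : M = (M.map e).map e.symm := by
    have := Ideal.map_symm (I := M.map e) e.toRingEquiv
    exact ((Ideal.comap_map_of_bijective e e.bijective).symm.trans this.symm)
  rw [hM, h, Ideal.map_span, Set.image_pair]

/-- A maximal ideal of a polynomial ring over a field consists of the polynomials vanishing at some
point over the algebraic closure. -/
theorem MvPolynomial.exists_aeval_eq_zero_iff_mem_of_isMaximal {K : Type*} [Field K] {σ : Type*}
    [Finite σ] (M : Ideal (MvPolynomial σ K)) [M.IsMaximal] :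
    ∃ p : σ → AlgebraicClosure K, ∀ f, aeval p f = 0 ↔ f ∈ M := by
  let _ : Field (MvPolynomial σ K ⧸ M) := Ideal.Quotient.field _
  have : Module.Finite K (MvPolynomial σ K ⧸ M) := finite_of_finite_type_of_isJacobsonRing _ _
  let l : (MvPolynomial σ K ⧸ M) →ₐ[K] AlgebraicClosure K := IsAlgClosed.lift
  refine ⟨fun i => l (Ideal.Quotient.mkₐ K M (X i)), fun f => ?_⟩
  have h : aeval (fun i => l (Ideal.Quotient.mkₐ K M (X i))) = l.comp (Ideal.Quotient.mkₐ K M) := by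
    ext i; simp
  rw [h, AlgHom.comp_apply, map_eq_zero_iff l l.toRingHom.injective, Ideal.Quotient.mkₐ_eq_mk,
    Ideal.Quotient.eq_zero_iff_mem]

theorem Ideal.isPrincipal_span_pair_of_isUnit {R : Type*} [CommRing R] {r s u v : R}
    (hr : IsUnit r) (h : r * u + s * v = 0) : (Ideal.span {u, v}).IsPrincipal := by
  obtain ⟨c, hc⟩ := hr.exists_left_inv
  refine ⟨⟨v, ?_⟩⟩
  rw [Ideal.submodule_span_eq, Ideal.span_insert, sup_eq_right, Ideal.span_singleton_le_iff_mem,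
    Ideal.mem_span_singleton]
  exact ⟨-(c * s), by linear_combination (-u) * hc + c * h⟩

theorem Localization.AtPrime.isPrincipal_maximalIdeal_of_eq_span_pair {R : Type*} [CommRing R]
    {m : Ideal R} [m.IsPrime] {r s u v : R} (hm : m = Ideal.span {u, v}) (hr : r ∉ m)
    (h : r * u + s * v = 0) :
    (IsLocalRing.maximalIdeal (Localization.AtPrime m)).IsPrincipal := by
  have hmax : IsLocalRing.maximalIdeal (Localization.AtPrime m) = Ideal.span
      {algebraMap R (Localization.AtPrime m) u, algebraMap R (Localization.AtPrime m) v} := by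
    rw [← Localization.AtPrime.map_eq_maximalIdeal, ← Set.image_pair, ← Ideal.map_span]
    exact congrArg (Ideal.map _) hm
  rw [hmax]
  refine Ideal.isPrincipal_span_pair_of_isUnit (s := algebraMap R _ s)
    (IsLocalization.map_units (M := m.primeCompl) _ ⟨r, hr⟩) ?_
  rw [← map_mul, ← map_mul, ← map_add, h, map_zero]

instance isIntegrallyClosedIn_range_algebraMap {R F : Type*} [CommRing R] [IsDomain R]
    [IsIntegrallyClosed R] [Field F] [Algebra R F] [IsFractionRing R F] :
    IsIntegrallyClosedIn (algebraMap R F).range F := by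
  rw [Subring.isIntegrallyClosedIn_iff]
  rintro x ⟨p, hp, hpx⟩
  obtain ⟨r, hr, -, hr'⟩ := Polynomial.lifts_and_natDegree_eq_and_monic
    ((Polynomial.mem_lifts p).2
      (Polynomial.map_surjective _ (algebraMap R F).rangeRestrict_surjective p)) hp
  refine IsIntegrallyClosed.isIntegral_iff.1 (⟨r, hr', ?_⟩ : IsIntegral R x)
  rw [← hr, Polynomial.eval₂_map] at hpx
  exact hpx

/-! ### The coordinate ring is integrally closed -/

namespace CabCurve

open MvPolynomial

variable {K : Type*} [Field K] {a b : ℕ} (C : CabCurve K a b)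

/-- Lift `m` to a maximal ideal `M = (u, v)` of `K[x, y]` and write the equation as `A u + B v`. If
`A` and `B` were both in `M`, all partial derivatives of the equation would vanish at the point of
`M`. So one of them is invertible in the local ring, where the relation `A u + B v = 0` then makes
`u` or `v` superfluous. -/
theorem isPrincipal_maximalIdeal (m : Ideal C.CoordinateRing) [m.IsMaximal] :
    (IsLocalRing.maximalIdeal (Localization.AtPrime m)).IsPrincipal := by
  let π := Ideal.Quotient.mk (Ideal.span {C.poly})
  have hπ : Function.Surjective π := Ideal.Quotient.mk_surjective
  have hM : (m.comap π).IsMaximal := Ideal.comap_isMaximal_of_surjective π hπ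
  obtain ⟨p, hp⟩ := MvPolynomial.exists_aeval_eq_zero_iff_mem_of_isMaximal (m.comap π)
  obtain ⟨u, v, huv⟩ := MvPolynomial.exists_span_pair_of_isMaximal (m.comap π)
  have hf0 : π C.poly = 0 := Ideal.Quotient.eq_zero_iff_mem.2 (Ideal.mem_span_singleton_self _)
  have hf : C.poly ∈ m.comap π := by
    rw [Ideal.mem_comap, hf0]; exact zero_mem _
  have hpu : aeval p u = 0 := (hp u).2 (huv ▸ Ideal.subset_span (by simp))
  have hpv : aeval p v = 0 := (hp v).2 (huv ▸ Ideal.subset_span (by simp))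
  obtain ⟨i, hi⟩ := C.nonsingular p ((hp _).2 hf)
  have hf' := hf
  rw [huv, Ideal.mem_span_pair] at hf'
  obtain ⟨A, B, hAB⟩ := hf'
  have hm : m = Ideal.span {π u, π v} := by
    rw [← Set.image_pair, ← Ideal.map_span, ← huv, Ideal.map_comap_of_surjective π hπ]
  have hrel : π A * π u + π B * π v = 0 := by
    rw [← map_mul, ← map_mul, ← map_add, hAB, hf0]
  have hor : A ∉ m.comap π ∨ B ∉ m.comap π := by
    by_contra! h
    have hA := (hp A).2 h.1
    have hB := (hp B).2 h.2
    apply hi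
    rw [← hAB]
    simp [Derivation.leibniz, hA, hB, hpu, hpv]
  rcases hor with h | h
  · exact Localization.AtPrime.isPrincipal_maximalIdeal_of_eq_span_pair hm h hrel
  · exact Localization.AtPrime.isPrincipal_maximalIdeal_of_eq_span_pair
      (hm.trans (by rw [Set.pair_comm])) h ((add_comm _ _).trans hrel)

instance isIntegrallyClosed_coordinateRing : IsIntegrallyClosed C.CoordinateRing := by
  refine IsIntegrallyClosed.of_localization_maximal fun m _ hm => ?_
  have : IsNoetherianRing (Localization.AtPrime m) :=
    IsLocalization.isNoetherianRing m.primeCompl _ inferInstance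
  have := ((tfae_of_isNoetherianRing_of_isLocalRing_of_isDomain (Localization.AtPrime m)).out 4 3).1
    (C.isPrincipal_maximalIdeal m)
  exact this.1

/-! ### The filtration by weighted degree -/

/-- The span of the monomials `x^i y^j`, with no bound on `j`, of weighted degree `ai + bj < d`. -/
noncomputable def filtration (d : ℕ) : Submodule K C.FunctionField :=
  Submodule.span K {m | ∃ i j : ℕ, a * i + b * j < d ∧ m = C.x ^ i * C.y ^ j}

/-- The span of the reduced monomials `x^i y^j`, those with `j < a`, of weighted degree
`ai + bj < d`. -/
noncomputable def reducedFiltration (d : ℕ) : Submodule K C.FunctionField :=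
  Submodule.span K {m | ∃ i j : ℕ, j < a ∧ a * i + b * j < d ∧ m = C.x ^ i * C.y ^ j}

variable {C}

theorem filtration_mono {d d' : ℕ} (h : d ≤ d') : C.filtration d ≤ C.filtration d' :=
  Submodule.span_mono fun _ ⟨i, j, h1, h2⟩ => ⟨i, j, h1.trans_le h, h2⟩

theorem reducedFiltration_mono {d d' : ℕ} (h : d ≤ d') :
    C.reducedFiltration d ≤ C.reducedFiltration d' :=
  Submodule.span_mono fun _ ⟨i, j, hj, h1, h2⟩ => ⟨i, j, hj, h1.trans_le h, h2⟩

theorem monomial_mem_filtration {i j d : ℕ} (h : a * i + b * j < d) :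
    C.x ^ i * C.y ^ j ∈ C.filtration d :=
  Submodule.subset_span ⟨i, j, h, rfl⟩

theorem monomial_mem_reducedFiltration {i j d : ℕ} (hj : j < a) (h : a * i + b * j < d) :
    C.x ^ i * C.y ^ j ∈ C.reducedFiltration d :=
  Submodule.subset_span ⟨i, j, hj, h, rfl⟩

theorem monomial_mul_mem_filtration {i j d d' : ℕ} {h : C.FunctionField}
    (hh : h ∈ C.filtration d) (hd : a * i + b * j + d ≤ d') :
    C.x ^ i * C.y ^ j * h ∈ C.filtration d' := by
  induction hh using Submodule.span_induction with
  | mem z hz =>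
    obtain ⟨u, v, huv, rfl⟩ := hz
    refine Submodule.subset_span ⟨i + u, j + v, ?_, by ring⟩
    rw [mul_add, mul_add]
    omega
  | zero => rw [mul_zero]; exact zero_mem _
  | add z w _ _ hz hw => rw [mul_add]; exact add_mem hz hw
  | smul c z _ hz => rw [mul_smul_comm]; exact Submodule.smul_mem _ c hz

variable (C) in
theorem algebraMap_mk (p : MvPolynomial (Fin 2) K) :
    algebraMap C.CoordinateRing C.FunctionField (Ideal.Quotient.mk _ p) =
      aeval ![C.x, C.y] p := by
  have h : ((IsScalarTower.toAlgHom K C.CoordinateRing C.FunctionField).comp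
      (Ideal.Quotient.mkₐ K (Ideal.span {C.poly}))) = aeval ![C.x, C.y] := by
    ext i
    fin_cases i <;> simp [x, y]
  exact DFunLike.congr_fun h p

variable (C) in
theorem aeval_poly : aeval ![C.x, C.y] C.poly = 0 := by
  rw [← algebraMap_mk, Ideal.Quotient.eq_zero_iff_mem.2 (Ideal.mem_span_singleton_self _), map_zero]

theorem aeval_eq_sum (p : MvPolynomial (Fin 2) K) :
    aeval ![C.x, C.y] p = ∑ e ∈ p.support, p.coeff e • (C.x ^ e 0 * C.y ^ e 1) := by
  rw [aeval_def, eval₂_eq']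
  simp [Fin.prod_univ_two, Algebra.smul_def]

variable (C) in
/-- Modulo lower weighted degree, the equation of the curve makes `y^a` a multiple of `x^b`. -/
theorem exists_y_pow_sub_smul_x_pow_mem :
    ∃ c : K, c ≠ 0 ∧ C.y ^ a - c • C.x ^ b ∈ C.filtration (a * b) := by
  classical
  set e1 : Fin 2 →₀ ℕ := Finsupp.single 1 a with he1
  set e0 : Fin 2 →₀ ℕ := Finsupp.single 0 b with he0
  have hne : e0 ≠ e1 := fun h => by
    have := DFunLike.congr_fun h 1
    simp [he0, he1] at this
    exact C.a_pos.ne this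
  have m1 : e1 ∈ C.poly.support := mem_support_iff.2 C.coeff_y
  have m0 : e0 ∈ C.poly.support.erase e1 :=
    Finset.mem_erase.2 ⟨hne, mem_support_iff.2 C.coeff_x⟩
  have h := C.aeval_poly
  rw [aeval_eq_sum, ← Finset.add_sum_erase _ _ m1, ← Finset.add_sum_erase _ _ m0] at h
  set r := ∑ e ∈ (C.poly.support.erase e1).erase e0, C.poly.coeff e • (C.x ^ e 0 * C.y ^ e 1)
    with hr
  have hrm : r ∈ C.filtration (a * b) := by
    refine sum_mem fun e he => Submodule.smul_mem _ _ (monomial_mem_filtration ?_)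
    obtain ⟨h0, h1, hs⟩ := by simpa [Finset.mem_erase] using he
    rcases C.support_le e (mem_support_iff.2 hs) with h | h | h
    · exact absurd h h1
    · exact absurd h h0
    · exact h
  have e11 : e1 1 = a := by simp [he1]
  have e10 : e1 0 = 0 := by simp [he1]
  have e01 : e0 1 = 0 := by simp [he0]
  have e00 : e0 0 = b := by simp [he0]
  rw [e11, e10, e01, e00, pow_zero, pow_zero, one_mul, mul_one] at h
  refine ⟨-((C.poly.coeff e1)⁻¹ * C.poly.coeff e0), ?_, ?_⟩
  · exact neg_ne_zero.2 (mul_ne_zero (inv_ne_zero C.coeff_y) C.coeff_x)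
  · have h2 : C.y ^ a - (-((C.poly.coeff e1)⁻¹ * C.poly.coeff e0)) • C.x ^ b
        = (-(C.poly.coeff e1)⁻¹) • r := by
      have h3 : C.y ^ a = (C.poly.coeff e1)⁻¹ • C.poly.coeff e1 • C.y ^ a := by
        rw [smul_smul, inv_mul_cancel₀ C.coeff_y, one_smul]
      have h4 : C.poly.coeff e1 • C.y ^ a = -(C.poly.coeff e0 • C.x ^ b + r) :=
        eq_neg_of_add_eq_zero_left h
      rw [h3, h4, smul_neg, smul_add, neg_smul, neg_smul, smul_smul]
      abel
    rw [h2]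
    exact Submodule.smul_mem _ _ hrm

/-- Trading a factor `y^a` for `x^b` keeps the weighted degree and changes a monomial by a nonzero
scalar, modulo lower weighted degree. -/
theorem exists_monomial_sub_smul_monomial_mem (i j : ℕ) :
    ∃ c : K, c ≠ 0 ∧ C.x ^ i * C.y ^ (j + a) - c • (C.x ^ (i + b) * C.y ^ j) ∈
      C.filtration (a * (i + b) + b * j) := by
  obtain ⟨c, hc, h⟩ := C.exists_y_pow_sub_smul_x_pow_mem
  refine ⟨c, hc, ?_⟩
  have := monomial_mul_mem_filtration (i := i) (j := j) (d' := a * (i + b) + b * j) h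
    (by rw [mul_add]; omega)
  convert this using 1
  rw [mul_sub, mul_smul_comm]
  congr 1
  · ring
  · congr 1; ring

theorem monomial_mem_reducedFiltration_of_lt {d : ℕ} :
    ∀ j i : ℕ, a * i + b * j < d → C.x ^ i * C.y ^ j ∈ C.reducedFiltration d := by
  induction d with
  | zero => intro j i h; omega
  | succ d ih =>
    intro j
    induction j using Nat.strong_induction_on with
    | _ j ihj =>
      intro i h
      rcases lt_or_ge j a with hj | hj
      · exact monomial_mem_reducedFiltration hj h
      · obtain ⟨k, rfl⟩ := Nat.exists_eq_add_of_le' hj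
        obtain ⟨c, -, hc⟩ := C.exists_monomial_sub_smul_monomial_mem i k
        have hw : a * (i + b) + b * k = a * i + b * (k + a) := by ring
        have h1 : C.filtration (a * (i + b) + b * k) ≤ C.reducedFiltration (d + 1) := by
          refine Submodule.span_le.2 ?_
          rintro _ ⟨u, v, huv, rfl⟩
          exact reducedFiltration_mono d.le_succ (ih v u (by omega))
        rw [← sub_add_cancel (C.x ^ i * C.y ^ (k + a)) (c • (C.x ^ (i + b) * C.y ^ k))]
        exact add_mem (h1 hc) (Submodule.smul_mem _ _
          (ihj k (by have := C.a_pos; omega) _ (by omega)))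

theorem filtration_eq_reducedFiltration (d : ℕ) : C.filtration d = C.reducedFiltration d := by
  refine le_antisymm (Submodule.span_le.2 ?_) (Submodule.span_mono ?_)
  · rintro _ ⟨i, j, h, rfl⟩
    exact monomial_mem_reducedFiltration_of_lt j i h
  · rintro _ ⟨i, j, -, h, rfl⟩
    exact ⟨i, j, h, rfl⟩

theorem exists_mem_filtration {h : C.FunctionField}
    (hh : h ∈ (algebraMap C.CoordinateRing C.FunctionField).range) : ∃ d, h ∈ C.filtration d := by
  obtain ⟨r, rfl⟩ := hh
  obtain ⟨p, rfl⟩ := Ideal.Quotient.mk_surjective r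
  rw [algebraMap_mk, aeval_eq_sum]
  refine ⟨p.support.sup (fun e => a * e 0 + b * e 1) + 1, sum_mem fun e he =>
    Submodule.smul_mem _ _ (monomial_mem_filtration (Nat.lt_succ_of_le ?_))⟩
  exact Finset.le_sup (f := fun e : Fin 2 →₀ ℕ => a * e 0 + b * e 1) he

theorem eq_of_weight_eq {i j i' j' : ℕ} (C : CabCurve K a b) (hj : j < a) (hj' : j' < a)
    (h : a * i + b * j = a * i' + b * j') : i = i' ∧ j = j' := by
  have h1 : b * j ≡ b * j' [MOD a] := by
    have : a * i + b * j ≡ a * i' + b * j' [MOD a] := by rw [h]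
    simpa [Nat.ModEq] using this
  have h2 : j = j' := (Nat.ModEq.cancel_left_of_coprime C.coprime h1).eq_of_lt_of_lt hj hj'
  subst h2
  exact ⟨Nat.eq_of_mul_eq_mul_left C.a_pos (Nat.add_right_cancel h), rfl⟩

/-- The quotient of two consecutive steps of the filtration is at most one-dimensional, spanned by
the reduced monomial of that weighted degree. -/
theorem exists_eq_add_smul_monomial_of_mem {d : ℕ} {h : C.FunctionField}
    (hh : h ∈ C.reducedFiltration (d + 1)) : h ∈ C.reducedFiltration d ∨
      ∃ i j : ℕ, j < a ∧ a * i + b * j = d ∧ ∃ c : K, c ≠ 0 ∧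
        h - c • (C.x ^ i * C.y ^ j) ∈ C.reducedFiltration d := by
  by_cases hd : ∃ i j : ℕ, j < a ∧ a * i + b * j = d
  · obtain ⟨i, j, hj, hij⟩ := hd
    have hle : C.reducedFiltration (d + 1) ≤
        C.reducedFiltration d ⊔ Submodule.span K {C.x ^ i * C.y ^ j} := by
      refine Submodule.span_le.2 ?_
      rintro _ ⟨u, v, hv, huv, rfl⟩
      rcases (Nat.lt_succ_iff.1 huv).lt_or_eq with h | h
      · exact Submodule.mem_sup_left (monomial_mem_reducedFiltration hv h)
      · obtain ⟨rfl, rfl⟩ := C.eq_of_weight_eq hv hj (h.trans hij.symm)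
        exact Submodule.mem_sup_right (Submodule.mem_span_singleton_self _)
    obtain ⟨y, hy, z, hz, rfl⟩ := Submodule.mem_sup.1 (hle hh)
    obtain ⟨c, rfl⟩ := Submodule.mem_span_singleton.1 hz
    rcases eq_or_ne c 0 with rfl | hc
    · left; simpa using hy
    · exact Or.inr ⟨i, j, hj, hij, c, hc, by simpa using hy⟩
  · left
    refine (Submodule.span_le.2 ?_ : C.reducedFiltration (d + 1) ≤ _) hh
    rintro _ ⟨u, v, hv, huv, rfl⟩
    exact monomial_mem_reducedFiltration hv
      ((Nat.lt_succ_iff.1 huv).lt_of_ne fun h => hd ⟨u, v, hv, h⟩)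

/-! ### Leading terms and division -/

theorem IsLeadingTerm.lt {h : C.FunctionField} {β α : ℕ} (H : C.IsLeadingTerm h β α) : α < a := H.1

theorem IsLeadingTerm.exists_sub_mem {h : C.FunctionField} {β α : ℕ} (H : C.IsLeadingTerm h β α) :
    ∃ c : K, c ≠ 0 ∧ h - c • (C.x ^ β * C.y ^ α) ∈ C.filtration (a * β + b * α) := by
  obtain ⟨c, hc, h⟩ := H.2
  exact ⟨c, hc, by rw [filtration_eq_reducedFiltration]; exact h⟩

theorem exists_isLeadingTerm {d : ℕ} {h : C.FunctionField} (hh : h ∈ C.filtration d)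
    (h0 : h ≠ 0) : ∃ β α : ℕ, C.IsLeadingTerm h β α ∧ a * β + b * α < d := by
  rw [filtration_eq_reducedFiltration] at hh
  induction d with
  | zero =>
    refine absurd ?_ h0
    have : C.reducedFiltration 0 ≤ ⊥ := by
      refine Submodule.span_le.2 ?_
      rintro _ ⟨u, v, hv, huv, rfl⟩
      omega
    exact (Submodule.mem_bot K).1 (this hh)
  | succ d ih =>
    rcases exists_eq_add_smul_monomial_of_mem hh with h1 | ⟨i, j, hj, rfl, c, hc, h1⟩
    · obtain ⟨β, α, h2, h3⟩ := ih h1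
      exact ⟨β, α, h2, h3.trans d.lt_succ_self⟩
    · exact ⟨i, j, ⟨hj, c, hc, h1⟩, Nat.lt_succ_self _⟩

theorem IsLeadingTerm.mem_filtration {h : C.FunctionField} {β α : ℕ} (H : C.IsLeadingTerm h β α) :
    h ∈ C.filtration (a * β + b * α + 1) := by
  obtain ⟨c, -, hc⟩ := H.exists_sub_mem
  rw [← sub_add_cancel h (c • (C.x ^ β * C.y ^ α))]
  exact add_mem (filtration_mono (Nat.le_succ _) hc)
    (Submodule.smul_mem _ _ (monomial_mem_filtration (Nat.lt_succ_self _)))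

/-- Each reduced monomial outside `R(g)` is, up to a nonzero scalar and modulo lower weighted
degree, a monomial multiple of `g`. -/
theorem exists_monomial_sub_smul_mul_mem {g : C.FunctionField} {β α : ℕ}
    (H : C.IsLeadingTerm g β α) {u v : ℕ} (hv : v < a)
    (h : ¬ (u < β + b ∧ ¬ (β ≤ u ∧ α ≤ v))) :
    ∃ (i j : ℕ) (c : K), C.x ^ u * C.y ^ v - c • (C.x ^ i * C.y ^ j * g) ∈
      C.filtration (a * u + b * v) := by
  obtain ⟨c, hc, hg⟩ := H.exists_sub_mem
  have key : ∀ i j : ℕ, C.x ^ (i + β) * C.y ^ (j + α) - c⁻¹ • (C.x ^ i * C.y ^ j * g) ∈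
      C.filtration (a * (i + β) + b * (j + α)) := by
    intro i j
    have h1 := Submodule.smul_mem _ (-c⁻¹) (monomial_mul_mem_filtration (i := i) (j := j)
      (d' := a * (i + β) + b * (j + α)) hg (by rw [mul_add, mul_add]; omega))
    convert h1 using 1
    rw [mul_sub, mul_smul_comm, smul_sub, smul_smul, neg_mul, inv_mul_cancel₀ hc, neg_smul,
      neg_smul, one_smul]
    ring
  by_cases h1 : β ≤ u ∧ α ≤ v
  · obtain ⟨i, rfl⟩ := Nat.exists_eq_add_of_le' h1.1
    obtain ⟨j, rfl⟩ := Nat.exists_eq_add_of_le' h1.2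
    exact ⟨i, j, c⁻¹, key i j⟩
  · obtain ⟨i, hi⟩ := Nat.exists_eq_add_of_le' (show β + b ≤ u by
      by_contra h2; exact h ⟨by omega, h1⟩)
    obtain ⟨j, hj⟩ := Nat.exists_eq_add_of_le' (show α ≤ v + a by have := H.lt; omega)
    -- here `v < α`, and `x^u y^v` is first rewritten as a multiple of `x^(u - b) y^(v + a)`
    obtain ⟨c', hc', h2⟩ := C.exists_monomial_sub_smul_monomial_mem (i + β) v
    have hu : i + β + b = u := by omega
    have h3 := key i j
    rw [← hj] at h3
    have hw : a * (i + β) + b * (v + a) = a * u + b * v := by rw [← hu]; ring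
    rw [hu] at h2
    rw [hw] at h3
    refine ⟨i, j, c'⁻¹ * c⁻¹, ?_⟩
    convert Submodule.smul_mem _ c'⁻¹ (sub_mem h3 h2) using 1
    rw [smul_sub, smul_sub, smul_sub, smul_smul, smul_smul, inv_mul_cancel₀ hc', one_smul]
    abel

/-- Division with remainder by `g` in each step of the filtration. -/
theorem exists_sub_mul_mem {g : C.FunctionField} {β α : ℕ} (H : C.IsLeadingTerm g β α) {d : ℕ} :
    ∀ f ∈ C.filtration d, ∃ f₁ ∈ Algebra.adjoin K {C.x, C.y},
      f - f₁ * g ∈ C.remainderSpace β α ⊓ C.filtration d := by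
  induction d with
  | zero =>
    intro f hf
    refine ⟨0, zero_mem _, ?_⟩
    have : f = 0 := by
      by_contra h0
      obtain ⟨_, _, -, h⟩ := exists_isLeadingTerm hf h0
      omega
    rw [this, zero_mul, sub_zero]
    exact zero_mem _
  | succ d ih =>
    intro f hf
    have hle : C.remainderSpace β α ⊓ C.filtration d ≤
        C.remainderSpace β α ⊓ C.filtration (d + 1) :=
      inf_le_inf_left _ (filtration_mono d.le_succ)
    rw [filtration_eq_reducedFiltration] at hf
    rcases exists_eq_add_smul_monomial_of_mem hf with h1 | ⟨u, v, hv, rfl, c, -, h1⟩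
    · rw [← filtration_eq_reducedFiltration] at h1
      obtain ⟨f₁, hf₁, h2⟩ := ih f h1
      exact ⟨f₁, hf₁, hle h2⟩
    · rw [← filtration_eq_reducedFiltration] at h1
      by_cases huv : u < β + b ∧ ¬ (β ≤ u ∧ α ≤ v)
      · obtain ⟨f₁, hf₁, h2⟩ := ih _ h1
        refine ⟨f₁, hf₁, ?_⟩
        have h3 : C.x ^ u * C.y ^ v ∈
            C.remainderSpace β α ⊓ C.filtration (a * u + b * v + 1) :=
          ⟨Submodule.subset_span ⟨u, v, huv.1, hv, huv.2, rfl⟩,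
            monomial_mem_filtration (Nat.lt_succ_self _)⟩
        convert add_mem (hle h2) (Submodule.smul_mem _ c h3) using 1
        abel
      · obtain ⟨i, j, c', h2⟩ := exists_monomial_sub_smul_mul_mem H hv huv
        obtain ⟨f₁, hf₁, h3⟩ := ih _ (add_mem h1 (Submodule.smul_mem _ c h2))
        refine ⟨f₁ + (c * c') • (C.x ^ i * C.y ^ j), add_mem hf₁ (Subalgebra.smul_mem _
          (mul_mem (pow_mem (Algebra.subset_adjoin (by simp)) _)
            (pow_mem (Algebra.subset_adjoin (by simp)) _)) _), ?_⟩
        convert hle h3 using 1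
        rw [smul_sub, smul_smul, add_mul, smul_mul_assoc]
        abel

/-! ### Valuations at infinity -/

namespace Place

theorem valuation_algebraMap_le_one (P : C.Place) (c : K) :
    P.regular.valuation (algebraMap K C.FunctionField c) ≤ 1 :=
  (P.regular.valuation_le_one_iff _).2 (P.const_mem c)

theorem valuation_smul (P : C.Place) {c : K} (hc : c ≠ 0) (h : C.FunctionField) :
    P.regular.valuation (c • h) = P.regular.valuation h := by
  have h1 : P.regular.valuation (algebraMap K C.FunctionField c) = 1 := by
    refine le_antisymm (P.valuation_algebraMap_le_one c) ?_
    have h2 := P.valuation_algebraMap_le_one c⁻¹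
    rw [map_inv₀, map_inv₀] at h2
    have h3 : P.regular.valuation (algebraMap K C.FunctionField c) ≠ 0 := by simpa using hc
    exact (inv_le_one₀ (zero_lt_iff.2 h3)).1 h2
  rw [Algebra.smul_def, map_mul, h1, one_mul]

theorem valuation_monomial_pow (P : C.Place) (i j : ℕ) :
    P.regular.valuation (C.x ^ i * C.y ^ j) ^ (a * b) =
      (P.regular.valuation C.x ^ b) ^ (a * i) * (P.regular.valuation C.y ^ a) ^ (b * j) := by
  rw [map_mul, map_pow, map_pow, mul_pow, ← pow_mul, ← pow_mul, ← pow_mul, ← pow_mul,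
    show i * (a * b) = b * (a * i) by ring, show j * (a * b) = a * (b * j) by ring]

/-- An upper bound for the valuation in terms of the weighted degree, from bounds on `x^b` and
`y^a`. -/
theorem valuation_pow_lt_of_mem_filtration (P : C.Place) {N : P.regular.ValueGroup} (hN : 1 < N)
    (hx : P.regular.valuation C.x ^ b ≤ N) (hy : P.regular.valuation C.y ^ a ≤ N) {d : ℕ}
    {h : C.FunctionField} (hh : h ∈ C.filtration d) :
    P.regular.valuation h ^ (a * b) < N ^ d := by
  have hab : a * b ≠ 0 := (Nat.mul_pos C.a_pos C.b_pos).ne'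
  have hN0 : 0 < N := zero_lt_one.trans hN
  induction hh using Submodule.span_induction with
  | mem z hz =>
    obtain ⟨i, j, hij, rfl⟩ := hz
    calc P.regular.valuation (C.x ^ i * C.y ^ j) ^ (a * b)
        = (P.regular.valuation C.x ^ b) ^ (a * i) * (P.regular.valuation C.y ^ a) ^ (b * j) :=
          P.valuation_monomial_pow i j
      _ ≤ N ^ (a * i) * N ^ (b * j) :=
          mul_le_mul' (pow_le_pow_left' hx _) (pow_le_pow_left' hy _)
      _ = N ^ (a * i + b * j) := (pow_add _ _ _).symm
      _ < N ^ d := pow_lt_pow_right₀ hN hij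
  | zero => rw [map_zero, zero_pow hab]; exact pow_pos hN0 _
  | add z w _ _ hz hw =>
    rcases le_total (P.regular.valuation z) (P.regular.valuation w) with h | h
    · exact (pow_le_pow_left' ((P.regular.valuation.map_add _ _).trans (max_le h le_rfl)) _).trans_lt
        hw
    · exact (pow_le_pow_left' ((P.regular.valuation.map_add _ _).trans (max_le le_rfl h)) _).trans_lt
        hz
  | smul c z _ hz =>
    refine lt_of_le_of_lt (pow_le_pow_left' ?_ _) hz
    rw [Algebra.smul_def, map_mul]
    exact mul_le_of_le_one_left' (P.valuation_algebraMap_le_one c)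

theorem IsAtInfinity.one_lt {P : C.Place} (hP : P.IsAtInfinity) :
    1 < P.regular.valuation C.x ^ b ∨ 1 < P.regular.valuation C.y ^ a := by
  refine hP.imp (fun h => one_lt_pow₀ ?_ C.b_pos.ne') (fun h => one_lt_pow₀ ?_ C.a_pos.ne') <;>
  · rw [← P.regular.valuation_le_one_iff] at h
    exact not_le.1 h

/-- At a place at infinity `x^b` and `y^a` have the same valuation: all other terms of the equation
of the curve are dominated by the larger of the two. -/
theorem IsAtInfinity.valuation_y_pow_eq {P : C.Place} (hP : P.IsAtInfinity) :
    P.regular.valuation C.y ^ a = P.regular.valuation C.x ^ b := by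
  set N := max (P.regular.valuation C.x ^ b) (P.regular.valuation C.y ^ a) with hN
  have hN1 : 1 < N := lt_max_iff.2 hP.one_lt
  obtain ⟨c, hc, hr⟩ := C.exists_y_pow_sub_smul_x_pow_mem
  have hlt := lt_of_pow_lt_pow_left₀ _ zero_le
    (P.valuation_pow_lt_of_mem_filtration hN1 (le_max_left _ _) (le_max_right _ _) hr)
  have hx : P.regular.valuation (c • C.x ^ b) = P.regular.valuation C.x ^ b := by
    rw [P.valuation_smul hc, map_pow]
  rcases lt_trichotomy (P.regular.valuation C.y ^ a) (P.regular.valuation C.x ^ b) with h | h | h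
  · rw [Valuation.map_sub_eq_of_lt_right _ (by rw [hx, map_pow]; exact h), hx, hN,
      max_eq_left h.le] at hlt
    exact absurd hlt (lt_irrefl _)
  · exact h
  · rw [Valuation.map_sub_eq_of_lt_left _ (by rw [hx, map_pow]; exact h), map_pow, hN,
      max_eq_right h.le] at hlt
    exact absurd hlt (lt_irrefl _)

theorem IsAtInfinity.one_lt_valuation_x_pow {P : C.Place} (hP : P.IsAtInfinity) :
    1 < P.regular.valuation C.x ^ b := by
  have := hP.one_lt
  rwa [hP.valuation_y_pow_eq, or_self] at this

theorem IsAtInfinity.valuation_monomial_pow {P : C.Place} (hP : P.IsAtInfinity) (i j : ℕ) :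
    P.regular.valuation (C.x ^ i * C.y ^ j) ^ (a * b) =
      (P.regular.valuation C.x ^ b) ^ (a * i + b * j) := by
  rw [P.valuation_monomial_pow, hP.valuation_y_pow_eq, pow_add]

/-- At a place at infinity the valuation of a function is that of its leading term, so it is
determined by the weighted degree. -/
theorem IsAtInfinity.valuation_pow_eq {P : C.Place} (hP : P.IsAtInfinity) {h : C.FunctionField}
    {β α : ℕ} (H : C.IsLeadingTerm h β α) :
    P.regular.valuation h ^ (a * b) = (P.regular.valuation C.x ^ b) ^ (a * β + b * α) := by
  obtain ⟨c, hc, hr⟩ := H.exists_sub_mem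
  have hlt := P.valuation_pow_lt_of_mem_filtration hP.one_lt_valuation_x_pow le_rfl
    hP.valuation_y_pow_eq.le hr
  rw [← hP.valuation_monomial_pow] at hlt
  have hlt' := lt_of_pow_lt_pow_left₀ _ zero_le hlt
  rw [← P.valuation_smul hc (C.x ^ β * C.y ^ α)] at hlt'
  rw [← hP.valuation_monomial_pow, ← P.valuation_smul hc (C.x ^ β * C.y ^ α),
    ← Valuation.map_add_eq_of_lt_left _ hlt', add_sub_cancel]

end Place

theorem IsLeadingTerm.ne_zero {P : C.Place} (hP : P.IsAtInfinity) {h : C.FunctionField} {β α : ℕ}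
    (H : C.IsLeadingTerm h β α) : h ≠ 0 := by
  rintro rfl
  have h1 := hP.valuation_pow_eq H
  rw [map_zero, zero_pow (Nat.mul_pos C.a_pos C.b_pos).ne'] at h1
  exact (pow_pos (zero_lt_one.trans hP.one_lt_valuation_x_pow) _).ne h1

theorem IsLeadingTerm.weight_eq {P : C.Place} (hP : P.IsAtInfinity) {h : C.FunctionField}
    {β α β' α' : ℕ} (H : C.IsLeadingTerm h β α) (H' : C.IsLeadingTerm h β' α') :
    a * β + b * α = a * β' + b * α' := by
  have h1 := (hP.valuation_pow_eq H).symm.trans (hP.valuation_pow_eq H')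
  exact pow_right_injective₀ (zero_lt_one.trans hP.one_lt_valuation_x_pow)
    hP.one_lt_valuation_x_pow.ne' h1

theorem IsLeadingTerm.wdeg_eq {P : C.Place} (hP : P.IsAtInfinity) {h : C.FunctionField}
    {β α : ℕ} (H : C.IsLeadingTerm h β α) : C.wdeg h = ((a * β + b * α : ℕ) : WithBot ℕ) := by
  have hs : {d : ℕ | ∃ β α : ℕ, C.IsLeadingTerm h β α ∧ d = a * β + b * α} =
      {a * β + b * α} := by
    ext d
    constructor
    · rintro ⟨β', α', H', rfl⟩
      exact H'.weight_eq hP H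
    · rintro rfl
      exact ⟨β, α, H, rfl⟩
  rw [wdeg, if_neg (H.ne_zero hP), hs, csInf_singleton]

theorem wdeg_le_of_mem_filtration {P : C.Place} (hP : P.IsAtInfinity) {h : C.FunctionField}
    {d : ℕ} (hh : h ∈ C.filtration (d + 1)) : C.wdeg h ≤ d := by
  rcases eq_or_ne h 0 with rfl | h0
  · rw [wdeg, if_pos rfl]; exact bot_le
  · obtain ⟨β, α, H, hlt⟩ := exists_isLeadingTerm hh h0
    rw [H.wdeg_eq hP]
    exact WithBot.coe_le_coe.2 (Nat.lt_succ_iff.1 hlt)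

/-- The existence of a place at infinity is only used to know that distinct
reduced monomials have distinct pole orders. -/
theorem linearIndependent_monomial {P : C.Place} (hP : P.IsAtInfinity) :
    LinearIndependent K fun e : {e : ℕ × ℕ // e.2 < a} => C.x ^ e.1.1 * C.y ^ e.1.2 := by
  classical
  rw [linearIndependent_iff']
  intro s g hg
  by_contra! hne
  obtain ⟨e, he, hge⟩ := hne
  obtain ⟨m, hm, hmax⟩ := Finset.exists_max_image (s.filter (g · ≠ 0))
    (fun e => a * e.1.1 + b * e.1.2) ⟨e, Finset.mem_filter.2 ⟨he, hge⟩⟩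
  obtain ⟨hms, hgm⟩ := Finset.mem_filter.1 hm
  refine IsLeadingTerm.ne_zero (h := ∑ i ∈ s, g i • (C.x ^ i.1.1 * C.y ^ i.1.2)) hP
    (⟨m.2, g m, hgm, ?_⟩ : C.IsLeadingTerm _ m.1.1 m.1.2) hg
  rw [← Finset.add_sum_erase _ _ hms, add_sub_cancel_left]
  refine sum_mem fun i hi => ?_
  obtain ⟨hne, hi⟩ := Finset.mem_erase.1 hi
  rcases eq_or_ne (g i) 0 with h0 | h0
  · rw [h0, zero_smul]; exact zero_mem _
  · refine Submodule.smul_mem _ _ (Submodule.subset_span ⟨_, _, i.2, ?_, rfl⟩)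
    refine (hmax i (Finset.mem_filter.2 ⟨hi, h0⟩)).lt_of_ne fun h => hne ?_
    obtain ⟨h1, h2⟩ := C.eq_of_weight_eq i.2 m.2 h
    exact Subtype.ext (Prod.ext h1 h2)

theorem finrank_remainderSpace {P : C.Place} (hP : P.IsAtInfinity) {β α : ℕ} (hα : α < a) :
    Module.finrank K (C.remainderSpace β α) = a * β + b * α := by
  classical
  -- the exponents of the monomials in `R(g)`: a rectangle with a corner removed
  let s : Finset (ℕ × ℕ) := (Finset.range (β + b) ×ˢ Finset.range a) \
    (Finset.Ico β (β + b) ×ˢ Finset.Ico α a)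
  have hs : ∀ e, e ∈ s ↔ e.1 < β + b ∧ e.2 < a ∧ ¬ (β ≤ e.1 ∧ α ≤ e.2) := by
    intro e
    simp only [s, Finset.mem_sdiff, Finset.mem_product, Finset.mem_range, Finset.mem_Ico]
    tauto
  have hcard : s.card = a * β + b * α := by
    have hsub : (Finset.Ico β (β + b) ×ˢ Finset.Ico α a) ⊆
        (Finset.range (β + b) ×ˢ Finset.range a) := by
      intro e he
      simp only [Finset.mem_product, Finset.mem_range, Finset.mem_Ico] at he ⊢
      exact ⟨he.1.2, he.2.2⟩
    rw [Finset.card_sdiff_of_subset hsub, Finset.card_product, Finset.card_product,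
      Finset.card_range, Finset.card_range, Nat.card_Ico, Nat.card_Ico, Nat.add_sub_cancel_left]
    obtain ⟨k, rfl⟩ := Nat.exists_eq_add_of_lt hα
    rw [show α + k + 1 - α = k + 1 by omega]
    refine Nat.sub_eq_of_eq_add ?_
    ring
  let ι : s → {e : ℕ × ℕ // e.2 < a} := fun e => ⟨e.1, ((hs _).1 e.2).2.1⟩
  have hι : Function.Injective ι := fun e e' h =>
    Subtype.ext (congrArg (fun e => e.val) h)
  have hli := (linearIndependent_monomial hP).comp ι hι
  have hspan : C.remainderSpace β α = Submodule.span K (Set.range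
      ((fun e : {e : ℕ × ℕ // e.2 < a} => C.x ^ e.1.1 * C.y ^ e.1.2) ∘ ι)) := by
    refine congrArg _ (Set.ext fun m => ⟨?_, ?_⟩)
    · rintro ⟨u, v, hu, hv, huv, rfl⟩
      exact ⟨⟨(u, v), (hs _).2 ⟨hu, hv, huv⟩⟩, rfl⟩
    · rintro ⟨e, rfl⟩
      obtain ⟨hu, hv, huv⟩ := (hs _).1 e.2
      exact ⟨_, _, hu, hv, huv, rfl⟩
  rw [hspan, finrank_span_eq_card hli, Fintype.card_coe, hcard]

/-! ### The place at infinity -/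

namespace Place

/-- A function `h / h'` is regular at a place at infinity precisely when the weighted degree of `h`
is at most that of `h'`, a condition which does not mention the place. -/
theorem IsAtInfinity.valuation_le_iff {P : C.Place} (hP : P.IsAtInfinity) {h h' : C.FunctionField}
    {β α β' α' : ℕ} (H : C.IsLeadingTerm h β α) (H' : C.IsLeadingTerm h' β' α') :
    P.regular.valuation h ≤ P.regular.valuation h' ↔ a * β + b * α ≤ a * β' + b * α' := by
  rw [← pow_le_pow_iff_left₀ zero_le zero_le (Nat.mul_pos C.a_pos C.b_pos).ne',
    hP.valuation_pow_eq H, hP.valuation_pow_eq H',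
    pow_le_pow_iff_right₀ hP.one_lt_valuation_x_pow]

end Place

theorem exists_div_isLeadingTerm {z : C.FunctionField} (hz : z ≠ 0) :
    ∃ h h' : C.FunctionField, z = h / h' ∧ h' ≠ 0 ∧ (∃ β α : ℕ, C.IsLeadingTerm h β α) ∧
      ∃ β α : ℕ, C.IsLeadingTerm h' β α := by
  obtain ⟨r, r', hr', rfl⟩ := IsFractionRing.div_surjective (A := C.CoordinateRing) z
  have key : ∀ r : C.CoordinateRing, algebraMap C.CoordinateRing C.FunctionField r ≠ 0 →
      ∃ β α : ℕ, C.IsLeadingTerm (algebraMap C.CoordinateRing C.FunctionField r) β α := by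
    intro r hr
    obtain ⟨d, hd⟩ := exists_mem_filtration ⟨r, rfl⟩
    obtain ⟨β, α, h, -⟩ := exists_isLeadingTerm hd hr
    exact ⟨β, α, h⟩
  obtain ⟨h1, h2⟩ := div_ne_zero_iff.1 hz
  exact ⟨_, _, rfl, h2, key r h1, key r' h2⟩

namespace Place

theorem IsAtInfinity.mem_of_mem {P Q : C.Place} (hP : P.IsAtInfinity) (hQ : Q.IsAtInfinity)
    {z : C.FunctionField} (hz : z ∈ P.regular) : z ∈ Q.regular := by
  rcases eq_or_ne z 0 with rfl | hz0
  · exact zero_mem _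
  obtain ⟨h, h', rfl, hne, ⟨β, α, H⟩, ⟨β', α', H'⟩⟩ := exists_div_isLeadingTerm hz0
  have key : ∀ R : C.Place, h / h' ∈ R.regular ↔
      R.regular.valuation h ≤ R.regular.valuation h' := by
    intro R
    rw [← R.regular.valuation_le_one_iff, map_div₀, div_le_one₀]
    exact zero_lt_iff.2 ((Valuation.ne_zero_iff _).2 hne)
  rw [key, hP.valuation_le_iff H H'] at hz
  rwa [key, hQ.valuation_le_iff H H']

/-- The curve has only one place at infinity. -/
theorem IsAtInfinity.eq {P Q : C.Place} (hP : P.IsAtInfinity) (hQ : Q.IsAtInfinity) : P = Q := by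
  have h : P.regular = Q.regular :=
    ValuationSubring.ext _ _ fun _ => ⟨hP.mem_of_mem hQ, hQ.mem_of_mem hP⟩
  cases P; cases Q; cases h; rfl

theorem mem_of_ne {P Q : C.Place} (hP : P.IsAtInfinity) (h : Q ≠ P) :
    C.x ∈ Q.regular ∧ C.y ∈ Q.regular := by
  by_contra hn
  rw [not_and_or] at hn
  exact h (IsAtInfinity.eq hn hP)

/-- A function vanishing at infinity is a quotient of functions of different weighted degrees,
so its valuation is bounded away from `1`. -/
theorem IsAtInfinity.mul_valuation_pow_le_one {P : C.Place} (hP : P.IsAtInfinity)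
    {t : C.FunctionField} (ht : t ∈ P.regular.nonunits) :
    P.regular.valuation C.x ^ b * P.regular.valuation t ^ (a * b) ≤ 1 := by
  rcases eq_or_ne t 0 with rfl | ht0
  · rw [map_zero, zero_pow (Nat.mul_pos C.a_pos C.b_pos).ne', mul_zero]
    exact zero_le_one
  obtain ⟨h, h', rfl, hne, ⟨β, α, H⟩, ⟨β', α', H'⟩⟩ := exists_div_isLeadingTerm ht0
  have h0 : 0 < P.regular.valuation h' := zero_lt_iff.2 ((Valuation.ne_zero_iff _).2 hne)
  have hlt : P.regular.valuation (h / h') < 1 := ht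
  rw [map_div₀, div_lt_one₀ h0, ← not_le, hP.valuation_le_iff H' H, not_le] at hlt
  rw [map_div₀, div_pow, ← mul_div_assoc, div_le_one₀ (pow_pos h0 _), hP.valuation_pow_eq H,
    hP.valuation_pow_eq H', ← pow_succ']
  exact pow_le_pow_right₀ hP.one_lt_valuation_x_pow.le hlt

theorem IsAtInfinity.monomial_mem_ringO {P : C.Place} (hP : P.IsAtInfinity) (i j : ℕ) :
    C.x ^ i * C.y ^ j ∈ P.ringO := by
  refine Set.mem_iUnion.2 ⟨a * i + b * j, fun Q hQ => ?_, fun t ht => ?_⟩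
  · obtain ⟨hx, hy⟩ := mem_of_ne hP hQ
    exact mul_mem (pow_mem hx _) (pow_mem hy _)
  · rw [← P.regular.valuation_le_one_iff,
      ← pow_le_one_iff_of_nonneg zero_le (Nat.mul_pos C.a_pos C.b_pos).ne', map_mul, mul_pow,
      hP.valuation_monomial_pow, map_pow, pow_right_comm (P.regular.valuation t), ← mul_pow]
    exact pow_le_one₀ zero_le (hP.mul_valuation_pow_le_one ht)

theorem IsAtInfinity.adjoin_le_ringO {P : C.Place} (hP : P.IsAtInfinity) :
    Algebra.adjoin K {C.x, C.y} ≤ P.ringO := by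
  refine Algebra.adjoin_le ?_
  rintro _ (rfl | rfl)
  · simpa using hP.monomial_mem_ringO 1 0
  · simpa using hP.monomial_mem_ringO 0 1

/-- Functions regular away from infinity are polynomials in `x` and `y`: the coordinate ring is
integrally closed, hence the intersection of the valuation rings containing it, and all those
are regular rings of places other than the one at infinity. -/
theorem IsAtInfinity.mem_range_of_mem_ringO {P : C.Place} (hP : P.IsAtInfinity)
    {h : C.FunctionField} (hh : h ∈ P.ringO) :
    h ∈ (algebraMap C.CoordinateRing C.FunctionField).range := by
  by_contra hn
  obtain ⟨V, hV, hVn⟩ := Subring.exists_le_valuationSubring_of_isIntegrallyClosedIn hn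
  obtain ⟨s, hs, -⟩ := Set.mem_iUnion.1 hh
  let Q : C.Place :=
    { regular := V
      const_mem := fun c => hV ⟨algebraMap K C.CoordinateRing c,
        (IsScalarTower.algebraMap_apply K C.CoordinateRing C.FunctionField c).symm⟩
      ne_top := by rintro rfl; exact hVn (ValuationSubring.mem_top _) }
  refine hVn (hs Q ?_)
  rintro rfl
  rcases hP with h1 | h1
  · exact h1 (hV ⟨_, rfl⟩)
  · exact h1 (hV ⟨_, rfl⟩)

end Place

end CabCurve

theorem mainTheorem7 {q m : ℕ} (hq : IsPrimePow q) (hm : 0 < m)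
    {K : Type*} [Field K] (hK : Nat.card K = q ^ m)
    {a b : ℕ} (C : CabCurve K a b) (P : C.Place) (hP : P.IsAtInfinity)
    (g : C.FunctionField) (hg : g ∈ P.ringO) (hg0 : g ≠ 0) :
    (∃ β α : ℕ, C.IsLeadingTerm g β α) ∧
    ∀ β α : ℕ, C.IsLeadingTerm g β α →
      (∀ f ∈ P.ringO, ∃ f₁ ∈ P.ringO, ∃ f₂ ∈ C.remainderSpace β α,
        f = f₁ * g + f₂ ∧ C.wdeg f₂ ≤ C.wdeg f) ∧
      (Module.finrank K (C.remainderSpace β α) : WithBot ℕ) = C.wdeg g := by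
  have hmem : ∀ f ∈ P.ringO, ∃ d, f ∈ C.filtration d := fun f hf =>
    CabCurve.exists_mem_filtration (hP.mem_range_of_mem_ringO hf)
  refine ⟨?_, fun β α H => ⟨fun f hf => ?_, ?_⟩⟩
  · obtain ⟨d, hd⟩ := hmem g hg
    obtain ⟨β, α, H, -⟩ := CabCurve.exists_isLeadingTerm hd hg0
    exact ⟨β, α, H⟩
  · rcases eq_or_ne f 0 with rfl | hf0
    · exact ⟨0, zero_mem _, 0, zero_mem _, by rw [zero_mul, add_zero], le_rfl⟩
    · obtain ⟨d, hd⟩ := hmem f hf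
      obtain ⟨β', α', H', -⟩ := CabCurve.exists_isLeadingTerm hd hf0
      obtain ⟨f₁, hf₁, hr, hd'⟩ := CabCurve.exists_sub_mul_mem H f H'.mem_filtration
      refine ⟨f₁, hP.adjoin_le_ringO hf₁, f - f₁ * g, hr, (add_sub_cancel _ _).symm, ?_⟩
      rw [H'.wdeg_eq hP]
      exact CabCurve.wdeg_le_of_mem_filtration hP hd'
  · rw [CabCurve.finrank_remainderSpace hP H.lt, H.wdeg_eq hP]
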